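/- Let $N$ be the number of ports, let $\eta>0$, and let $R\in\mathbb{C}^{N\times N}$ be a Hermitian positive semidefinite (correlation) matrix, for instance the Jakes correlation matrix $R_{k,l}=J_0\big(2\pi|k-l|W/(N-1)\big)$. Let $R=U\Lambda U^H$ be any eigendecomposition with $U=(u_{n,k})$ unitary and $\Lambda=\mathrm{diag}(\lambda_1,\dots,\lambda_N)$, $\lambda_1\ge\lambda_2\ge\cdots\ge\lambda_N\ (\ge 0)$. Let $g=(g_1,\dots,g_N)\sim\mathcal{CN}(0,\eta R)$ be a circularly symmetric complex Gaussian channel vector, let $z=(z_1,\dots,z_N)\sim\mathcal{CN}(0,I_N)$ be a vector of i.i.d. standard complex Gaussian variables, and for $0\le K\le N$ let the rank-$K$ truncated Karhunen--Loève channel be $$\tilde g_n^{(K)}=\sqrt{\eta}\sum_{k=1}^{K}\sqrt{\lambda_k}\,u_{n,k}\,z_k,\qquad n=1,\dots,N .$$ Write $F_{\max}(x)=\mathbb{P}\big(\max_n |g_n|^2/\eta\le x\big)$ and $\tilde F_{\max}^{(K)}(x)=\mathbb{P}\big(\max_n |\tilde g_n^{(K)}|^2/\eta\le x\big)$. Then,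 for every truncation order $K\le N$ and every threshold $x>0$, $$\tilde F_{\max}^{(K)}(x)\ \ge\ F_{\max}(x).$$ Equivalently, for every average SNR $\bar\gamma>0$ and every SNR threshold $\gamma_{\mathrm{th}}>0$, the outage probabilities $P_{\mathrm{out}}=\mathbb{P}\big(\bar\gamma\max_n|g_n|^2/\eta\le\gamma_{\mathrm{th}}\big)$ and $\tilde P_{\mathrm{out}}^{(K)}=\mathbb{P}\big(\bar\gamma\max_n|\tilde g^{(K)}_n|^2/\eta\le\gamma_{\mathrm{th}}\big)$ satisfy $\tilde P_{\mathrm{out}}^{(K)}\ge P_{\mathrm{out}}$. -/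

import Mathlib

open MeasureTheory ProbabilityTheory
open scoped Matrix ComplexOrder

noncomputable section

/-- The covariance matrix of the real vector `(Re g, Im g)` when `g` is a circularly symmetric
complex Gaussian vector with complex covariance matrix `S = E[g gᴴ]`. -/
def realCompositeCov {N : ℕ} (S : Matrix (Fin N) (Fin N) ℂ) :
    Matrix (Fin N ⊕ Fin N) (Fin N ⊕ Fin N) ℝ :=
  (1 / 2 : ℝ) • Matrix.fromBlocks (S.map Complex.re) (-S.map Complex.im)
    (S.map Complex.im) (S.map Complex.re)

/-- The centred circularly symmetric complex Gaussian law `CN(0, S)` on `ℂ^N`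
(for a Hermitian positive semidefinite `S`). -/
def complexGaussian {N : ℕ} (S : Matrix (Fin N) (Fin N) ℂ) : Measure (Fin N → ℂ) :=
  (multivariateGaussian 0 (realCompositeCov S)).map
    (fun v n => (⟨v (Sum.inl n), v (Sum.inr n)⟩ : ℂ))

/-- The normalized maximum port gain `max_n |g_n|² / η`. -/
def maxGain {N : ℕ} (η : ℝ) (g : Fin N → ℂ) : ℝ :=
  ⨆ n, ‖g n‖ ^ 2 / η

/-- The cumulative distribution function of the normalized maximum port gain
of a random channel vector `g`. -/
def maxGainCDF {Ω : Type*} [MeasurableSpace Ω] {N : ℕ} (P : Measure Ω) (η : ℝ)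
    (g : Ω → Fin N → ℂ) (x : ℝ) : ℝ :=
  P.real {ω | maxGain η (g ω) ≤ x}

/-- The outage probability of a random channel vector `g`: the probability that the instantaneous
SNR `γbar * max_n |g_n|² / η` at the best port does not exceed the threshold `γth`. -/
def outageProb {Ω : Type*} [MeasurableSpace Ω] {N : ℕ} (P : Measure Ω) (η γbar : ℝ)
    (g : Ω → Fin N → ℂ) (γth : ℝ) : ℝ :=
  P.real {ω | γbar * maxGain η (g ω) ≤ γth}

/-- The Karhunen–Loève expansion truncated to its first `K` modes:
port `n` has the coefficient `√η ∑_{k ≤ K} √(λ_k) u_{n,k} z_k` (modes are indexed from `0`). -/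
def klTruncation {N : ℕ} (η : ℝ) (U : Matrix (Fin N) (Fin N) ℂ) (lam : Fin N → ℝ) (K : ℕ)
    (z : Fin N → ℂ) : Fin N → ℂ :=
  fun n => (√η : ℂ) * ∑ k : Fin N with k.val < K, (√(lam k) : ℂ) * U n k * z k

/-- The Bessel function of the first kind of order zero, by Bessel's integral. -/
def besselJZero (x : ℝ) : ℝ :=
  (1 / Real.pi) * ∫ θ in (0 : ℝ)..Real.pi, Real.cos (x * Real.sin θ)

/-- The Jakes correlation matrix of `N` ports with normalized aperture `W`. -/
def jakesCorrelation (N : ℕ) (W : ℝ) : Matrix (Fin N) (Fin N) ℂ :=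
  fun k l => (besselJZero (2 * Real.pi * |(k.val : ℝ) - (l.val : ℝ)| * W / ((N : ℝ) - 1)) : ℂ)

/-- The Jakes correlation matrix is Hermitian positive semidefinite. -/
theorem jakesCorrelation_posSemidef (N : ℕ) (W : ℝ) : (jakesCorrelation N W).PosSemidef := by
  have hent : ∀ k l : Fin N, jakesCorrelation N W k l =
      ∫ θ in (0 : ℝ)..Real.pi, ((1 / Real.pi *
        Real.cos (((k.val : ℝ) - l.val) * (2 * Real.pi * W / ((N : ℝ) - 1) * Real.sin θ)) : ℝ) :
        ℂ) := by
    intro k l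
    rw [intervalIntegral.integral_ofReal, intervalIntegral.integral_const_mul]
    unfold jakesCorrelation besselJZero
    congr 3
    funext θ
    rcases abs_cases ((k.val : ℝ) - l.val) with h | h <;> rw [h.1]
    · congr 1; ring
    · rw [← Real.cos_neg]; congr 1; ring
  refine Matrix.PosSemidef.of_dotProduct_mulVec_nonneg ?_ ?_
  · ext k l
    simp only [Matrix.conjTranspose_apply, jakesCorrelation, RCLike.star_def, Complex.conj_ofReal]
    rw [abs_sub_comm]
  · intro c
    have hint : ∀ k l : Fin N, IntervalIntegrable (fun θ : ℝ => star (c k) * (((1 / Real.pi *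
        Real.cos (((k.val : ℝ) - l.val) * (2 * Real.pi * W / ((N : ℝ) - 1) * Real.sin θ)) : ℝ) :
        ℂ) * c l)) volume 0 Real.pi := fun k l => by
      apply Continuous.intervalIntegrable
      fun_prop
    have hsum : star c ⬝ᵥ (jakesCorrelation N W *ᵥ c) = ∫ θ in (0 : ℝ)..Real.pi,
        ∑ k : Fin N, ∑ l : Fin N, star (c k) * (((1 / Real.pi *
        Real.cos (((k.val : ℝ) - l.val) * (2 * Real.pi * W / ((N : ℝ) - 1) * Real.sin θ)) : ℝ) :
        ℂ) * c l) := by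
      rw [intervalIntegral.integral_finsetSum]
      · simp only [dotProduct, Matrix.mulVec, Finset.mul_sum, Pi.star_apply]
        refine Finset.sum_congr rfl fun k _ => ?_
        rw [intervalIntegral.integral_finsetSum (fun l _ => hint k l)]
        refine Finset.sum_congr rfl fun l _ => ?_
        rw [intervalIntegral.integral_const_mul, intervalIntegral.integral_mul_const, hent]
      · intro k _
        apply Continuous.intervalIntegrable
        fun_prop
    rw [hsum]
    have hsq : ∀ θ : ℝ, ∑ k : Fin N, ∑ l : Fin N, star (c k) * (((1 / Real.pi *
        Real.cos (((k.val : ℝ) - l.val) * (2 * Real.pi * W / ((N : ℝ) - 1) * Real.sin θ)) : ℝ) :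
        ℂ) * c l) = ((1 / Real.pi * (
        ‖∑ l : Fin N, (Real.cos (l.val * (2 * Real.pi * W / ((N : ℝ) - 1) * Real.sin θ)) : ℂ)
          * c l‖ ^ 2 +
        ‖∑ l : Fin N, (Real.sin (l.val * (2 * Real.pi * W / ((N : ℝ) - 1) * Real.sin θ)) : ℂ)
          * c l‖ ^ 2) : ℝ) : ℂ) := by
      intro θ
      push_cast
      rw [← Complex.conj_mul', ← Complex.conj_mul', map_sum, map_sum, Finset.sum_mul_sum,
        Finset.sum_mul_sum, ← Finset.sum_add_distrib, Finset.mul_sum]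
      refine Finset.sum_congr rfl fun k _ => ?_
      rw [← Finset.sum_add_distrib, Finset.mul_sum]
      refine Finset.sum_congr rfl fun l _ => ?_
      simp only [map_mul, ← Complex.ofReal_cos, ← Complex.ofReal_sin, ← Complex.ofReal_natCast,
        ← Complex.ofReal_sub, ← Complex.ofReal_mul, ← Complex.ofReal_ofNat, ← Complex.ofReal_one,
        ← Complex.ofReal_div, Complex.conj_ofReal]
      rw [sub_mul, Real.cos_sub]
      push_cast
      simp only [RCLike.star_def]
      ring
    simp only [hsq]
    rw [intervalIntegral.integral_ofReal]
    rw [Complex.zero_le_real]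
    refine intervalIntegral.integral_nonneg Real.pi_pos.le fun θ _ => ?_
    have := Real.pi_pos
    positivity

/-- The Jakes correlation matrix has unit diagonal. -/
theorem jakesCorrelation_diag (N : ℕ) (W : ℝ) (n : Fin N) : jakesCorrelation N W n n = 1 := by
  simp [jakesCorrelation, besselJZero, Real.pi_ne_zero]

end

/-! Splitting the Karhunen–Loève modes into kept and discarded ones gives `η • R = A * Aᴴ + B * Bᴴ`,
so the full channel has the law of the truncated channel plus an independent centred Gaussian. The
event that the maximum gain is at most `x` is a closed sup-norm ball, which is convex and symmetric.
By Anderson's inequality every shift lowers its mass under the truncated law; averaging over the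
discarded part gives `complexGaussian_add_le`.

Anderson's inequality comes from the midpoint Prékopa–Leindler inequality, which follows on the line
from Brunn–Minkowski by the layer-cake formula and passes to log-concave densities, products and
linear images. Stating it as a property of measures rather than densities matters: the truncated law
may be singular. -/

/-! ### Brunn–Minkowski and Prékopa–Leindler on the real line. -/

open scoped Pointwise in
/-- The one-dimensional Brunn–Minkowski inequality for compact sets. -/
theorem volume_add_volume_le_volume_add {K L : Set ℝ} (hK : IsCompact K) (hL : IsCompact L)
    (hK' : K.Nonempty) (hL' : L.Nonempty) : volume K + volume L ≤ volume (K + L) := by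
  obtain ⟨b, hbK, hb⟩ := hK.exists_isGreatest hK'
  obtain ⟨a, haL, ha⟩ := hL.exists_isLeast hL'
  -- With `b = max K` and `a = min L`, the two translates can meet only at `a + b`.
  have hsub : (a +ᵥ K) ∪ (b +ᵥ L) ⊆ K + L := by
    rintro _ (⟨x, hx, rfl⟩ | ⟨x, hx, rfl⟩)
    · exact ⟨x, hx, a, haL, by simp [add_comm]⟩
    · exact ⟨b, hbK, x, hx, rfl⟩
  have hdisj : AEDisjoint volume (a +ᵥ K) (b +ᵥ L) := by
    refine measure_mono_null (t := {a + b}) ?_ (by simp)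
    rintro _ ⟨⟨x, hx, rfl⟩, ⟨y, hy, hxy⟩⟩
    have h1 := hb hx
    have h2 := ha hy
    simp only [vadd_eq_add, Set.mem_singleton_iff] at *
    linarith
  calc volume K + volume L = volume (a +ᵥ K) + volume (b +ᵥ L) := by
        rw [measure_vadd, measure_vadd]
    _ = volume ((a +ᵥ K) ∪ (b +ᵥ L)) :=
        (measure_union₀ (hL.vadd b).measurableSet.nullMeasurableSet hdisj).symm
    _ ≤ volume (K + L) := measure_mono hsub

open scoped Pointwise in
/-- The one-dimensional Brunn–Minkowski inequality for midpoints of measurable sets. -/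
theorem volume_add_volume_le_two_mul {A B M : Set ℝ} (hA : MeasurableSet A)
    (hB : MeasurableSet B) (hA' : A.Nonempty) (hB' : B.Nonempty)
    (hM : ∀ a ∈ A, ∀ b ∈ B, (2⁻¹ : ℝ) • (a + b) ∈ M) :
    volume A + volume B ≤ 2 * volume M := by
  obtain ⟨a, ha⟩ := hA'
  obtain ⟨b, hb⟩ := hB'
  have h2 : volume ((2 : ℝ) • M) = 2 * volume M := by
    rw [Measure.addHaar_smul]; simp
  rw [← h2, hA.measure_eq_iSup_isCompact, hB.measure_eq_iSup_isCompact]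
  simp only [iSup_and']
  refine ENNReal.biSup_add_biSup_le' ⟨∅, by simp⟩ ⟨∅, by simp⟩ fun K hK L hL => ?_
  -- The approximating compacts may be empty; adjoining a point of each set repairs this.
  calc volume K + volume L ≤ volume (insert a K) + volume (insert b L) := by
        gcongr <;> exact Set.subset_insert _ _
    _ ≤ volume (insert a K + insert b L) := volume_add_volume_le_volume_add
        (hK.2.insert a) (hL.2.insert b) (Set.insert_nonempty _ _) (Set.insert_nonempty _ _)
    _ ≤ volume ((2 : ℝ) • M) := by
        refine measure_mono ?_
        rintro _ ⟨x, hx, y, hy, rfl⟩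
        refine ⟨(2⁻¹ : ℝ) • (x + y), hM x (Set.insert_subset ha hK.1 hx) y
          (Set.insert_subset hb hL.1 hy), ?_⟩
        simp

theorem ENNReal.mul_le_sq_of_add_le_two_mul {a b c : ENNReal} (h : a + b ≤ 2 * c) :
    a * b ≤ c ^ 2 := by
  rcases eq_or_ne c ⊤ with rfl | hc
  · simp
  have hab : a + b ≠ ⊤ := ne_top_of_le_ne_top (ENNReal.mul_ne_top (by simp) hc) h
  rw [ENNReal.add_ne_top] at hab
  lift a to NNReal using hab.1
  lift b to NNReal using hab.2
  lift c to NNReal using hc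
  norm_cast at *
  rw [← NNReal.coe_le_coe] at *
  push_cast at *
  nlinarith [sq_nonneg ((a : ℝ) - b), a.2, b.2, c.2, sq_nonneg ((a : ℝ) + b)]

theorem lintegral_eq_setLIntegral_Ioo_measure_lt {α : Type*} [MeasurableSpace α] {μ : Measure α}
    {f : α → ENNReal} (hf : Measurable f) (hf1 : ∀ x, f x ≤ 1) :
    ∫⁻ x, f x ∂μ = ∫⁻ t in Set.Ioo (0 : ℝ) 1, μ {x | ENNReal.ofReal t < f x} := by
  have hfin : ∀ x, f x ≠ ⊤ := fun x => ne_top_of_le_ne_top (by simp) (hf1 x)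
  have h := lintegral_eq_lintegral_meas_lt μ (f := fun x => (f x).toReal)
    (Filter.Eventually.of_forall fun x => ENNReal.toReal_nonneg) hf.ennreal_toReal.aemeasurable
  simp only [fun x => ENNReal.ofReal_toReal (hfin x)] at h
  have hset : ∀ t ∈ Set.Ioi (0 : ℝ), μ {x | t < (f x).toReal} =
      μ {x | ENNReal.ofReal t < f x} := fun t ht => by
    congr 1; ext x
    exact (ENNReal.ofReal_lt_iff_lt_toReal (le_of_lt ht) (hfin x)).symm
  rw [h, setLIntegral_congr_fun measurableSet_Ioi hset,
    ← Set.Ioo_union_Ici_eq_Ioi (zero_lt_one' ℝ), lintegral_union measurableSet_Ici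
      (Set.disjoint_left.2 fun x hx hx' => absurd hx.2 (not_lt.2 hx')),
    setLIntegral_congr_fun (g := fun _ => 0) measurableSet_Ici, lintegral_zero, add_zero]
  intro t ht
  have : {x | ENNReal.ofReal t < f x} = ∅ := by
    ext x
    simpa using (hf1 x).trans (by simpa using ht)
  simp [this]

/-- The Prékopa–Leindler property of a measure, for midpoints. -/
def MidpointPrekopaLeindler {E : Type*} [Add E] [SMul ℝ E] [MeasurableSpace E]
    (μ : Measure E) : Prop :=
  ∀ f g h : E → ENNReal, Measurable f → Measurable g → Measurable h →
    (∀ x y, f x * g y ≤ h ((2⁻¹ : ℝ) • (x + y)) ^ 2) →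
      (∫⁻ x, f x ∂μ) * (∫⁻ x, g x ∂μ) ≤ (∫⁻ x, h x ∂μ) ^ 2

/-- Equal suprema make the superlevel sets of `f` and `g` nonempty at every level below 1, as
Brunn–Minkowski requires. Integrating it over levels bounds the sum of the integrals, and AM–GM
turns this into the product bound. -/
theorem prekopaLeindler_of_iSup_eq_one {f g h : ℝ → ENNReal} (hf : Measurable f)
    (hg : Measurable g) (hh : Measurable h) (hf1 : (⨆ x, f x) = 1) (hg1 : (⨆ x, g x) = 1)
    (hfgh : ∀ x y, f x * g y ≤ h ((2⁻¹ : ℝ) • (x + y)) ^ 2) :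
    (∫⁻ x, f x) * (∫⁻ x, g x) ≤ (∫⁻ x, h x) ^ 2 := by
  have hfle : ∀ x, f x ≤ 1 := fun x => hf1 ▸ le_iSup f x
  have hgle : ∀ x, g x ≤ 1 := fun x => hg1 ▸ le_iSup g x
  -- Capping `h` at 1 keeps the hypothesis, since `f` and `g` are at most 1, and confines all three
  -- layer-cake integrals to levels in `(0, 1)`.
  set k : ℝ → ENNReal := fun x => min (h x) 1 with hk
  have hkm : Measurable k := hh.min measurable_const
  have hfgk : ∀ x y, f x * g y ≤ k ((2⁻¹ : ℝ) • (x + y)) ^ 2 := fun x y => by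
    rcases min_cases (h ((2⁻¹ : ℝ) • (x + y))) 1 with h' | h' <;> simp only [hk, h'.1]
    · exact hfgh x y
    · simpa using mul_le_mul' (hfle x) (hgle y)
  refine le_trans (ENNReal.mul_le_sq_of_add_le_two_mul (c := ∫⁻ x, k x) ?_)
    (pow_le_pow_left' (lintegral_mono fun x => min_le_left _ _) 2)
  have hmeas : ∀ {u : ℝ → ENNReal}, Measurable u →
      Measurable fun t : ℝ => volume {x | ENNReal.ofReal t < u x} := fun hu => by
    refine Antitone.measurable fun s t hst => measure_mono fun x hx => ?_
    exact lt_of_le_of_lt (ENNReal.ofReal_le_ofReal hst) hx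
  rw [lintegral_eq_setLIntegral_Ioo_measure_lt hf hfle,
    lintegral_eq_setLIntegral_Ioo_measure_lt hg hgle,
    lintegral_eq_setLIntegral_Ioo_measure_lt hkm (fun x => min_le_right _ _),
    ← lintegral_add_left (hmeas hf), ← lintegral_const_mul _ (hmeas hkm)]
  refine setLIntegral_mono ((hmeas hkm).const_mul _) fun t ht => ?_
  have ht1 : ENNReal.ofReal t < 1 := by simpa using ht.2
  have hfne : {x | ENNReal.ofReal t < f x}.Nonempty := by
    rw [← hf1, lt_iSup_iff] at ht1
    exact ht1
  have hgne : {x | ENNReal.ofReal t < g x}.Nonempty := by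
    rw [← hg1, lt_iSup_iff] at ht1
    exact ht1
  refine volume_add_volume_le_two_mul (measurableSet_lt measurable_const hf)
    (measurableSet_lt measurable_const hg) hfne hgne fun a ha b hb => ?_
  by_contra hcon
  have h1 := (hfgk a b).trans (pow_le_pow_left' (not_lt.1 hcon) 2)
  rw [sq] at h1
  exact absurd h1 (not_le.2 (ENNReal.mul_lt_mul ha hb))

theorem prekopaLeindler_of_bounded {f g h : ℝ → ENNReal} (hf : Measurable f)
    (hg : Measurable g) (hh : Measurable h) (hf1 : (⨆ x, f x) ≠ ⊤) (hg1 : (⨆ x, g x) ≠ ⊤)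
    (hfgh : ∀ x y, f x * g y ≤ h ((2⁻¹ : ℝ) • (x + y)) ^ 2) :
    (∫⁻ x, f x) * (∫⁻ x, g x) ≤ (∫⁻ x, h x) ^ 2 := by
  set a := ⨆ x, f x with ha
  set b := ⨆ x, g x with hb
  rcases eq_or_ne a 0 with ha0 | ha0
  · have : ∀ x, f x = 0 := by simpa [ha0] using ha.symm
    simp [this]
  rcases eq_or_ne b 0 with hb0 | hb0
  · have : ∀ x, g x = 0 := by simpa [hb0] using hb.symm
    simp [this]
  -- Dividing `f`, `g`, `h` by `a`, `b`, `√(a * b)` preserves the hypothesis.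
  obtain ⟨c, hc⟩ : ∃ c : ENNReal, c ^ 2 = a * b :=
    ⟨(a * b) ^ (2⁻¹ : ℝ), by rw [← ENNReal.rpow_natCast, ← ENNReal.rpow_mul]; simp⟩
  have hab0 : a * b ≠ 0 := mul_ne_zero ha0 hb0
  have habt : a * b ≠ ⊤ := ENNReal.mul_ne_top hf1 hg1
  have hinv : (c⁻¹) ^ 2 = a⁻¹ * b⁻¹ := by
    rw [← ENNReal.inv_pow, hc, ENNReal.mul_inv (Or.inl ha0) (Or.inl hf1)]
  have key := prekopaLeindler_of_iSup_eq_one (f := fun x => a⁻¹ * f x) (g := fun x => b⁻¹ * g x)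
    (h := fun x => c⁻¹ * h x) (hf.const_mul _) (hg.const_mul _) (hh.const_mul _)
    (by rw [← ENNReal.mul_iSup, ← ha, ENNReal.inv_mul_cancel ha0 hf1])
    (by rw [← ENNReal.mul_iSup, ← hb, ENNReal.inv_mul_cancel hb0 hg1]) fun x y => by
      rw [mul_pow, hinv, mul_mul_mul_comm]
      gcongr
      exact hfgh x y
  rw [lintegral_const_mul _ hf, lintegral_const_mul _ hg, lintegral_const_mul _ hh, mul_pow, hinv,
    mul_mul_mul_comm, ← ENNReal.mul_inv (Or.inl ha0) (Or.inl hf1)] at key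
  exact (ENNReal.mul_le_mul_iff_right (ENNReal.inv_ne_zero.2 habt)
    (ENNReal.inv_ne_top.2 hab0)).1 key

/-- Truncation at height `n` and monotone convergence remove the boundedness assumption. -/
theorem midpointPrekopaLeindler_volume : MidpointPrekopaLeindler (volume : Measure ℝ) := by
  intro f g h hf hg hh hfgh
  have hsup : ∀ {u : ℝ → ENNReal}, Measurable u →
      ∫⁻ x, u x = ⨆ n : ℕ, ∫⁻ x, min (u x) n := fun {u} hu => by
    rw [← lintegral_iSup (fun n => hu.min measurable_const)
      fun m n hmn x => min_le_min_left _ (by exact_mod_cast hmn)]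
    refine lintegral_congr fun x => ?_
    rw [← inf_iSup_eq, ENNReal.iSup_natCast, inf_top_eq]
  have hbdd : ∀ (u : ℝ → ENNReal) (n : ℕ), (⨆ x, min (u x) (n : ENNReal)) ≠ ⊤ := fun u n =>
    ne_top_of_le_ne_top (ENNReal.natCast_ne_top n) (iSup_le fun x => min_le_right _ _)
  rw [hsup hf, hsup hg, ENNReal.iSup_mul]
  simp only [ENNReal.mul_iSup]
  refine iSup₂_le fun m n => prekopaLeindler_of_bounded (hf.min measurable_const)
    (hg.min measurable_const) hh (hbdd f _) (hbdd g _) fun x y => le_trans ?_ (hfgh x y)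
  exact mul_le_mul' (min_le_left _ _) (min_le_left _ _)

/-! ### Stability of the Prékopa–Leindler property, Gaussian laws and Anderson's inequality. -/

theorem MidpointPrekopaLeindler.withDensity {E : Type*} [Add E] [SMul ℝ E] [MeasurableSpace E]
    {μ : Measure E} (hμ : MidpointPrekopaLeindler μ) {ρ : E → ENNReal} (hρ : Measurable ρ)
    (hρ' : ∀ x y, ρ x * ρ y ≤ ρ ((2⁻¹ : ℝ) • (x + y)) ^ 2) :
    MidpointPrekopaLeindler (μ.withDensity ρ) := by
  intro f g h hf hg hh hfgh
  rw [lintegral_withDensity_eq_lintegral_mul _ hρ hf, lintegral_withDensity_eq_lintegral_mul _ hρ hg,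
    lintegral_withDensity_eq_lintegral_mul _ hρ hh]
  refine hμ _ _ _ (hρ.mul hf) (hρ.mul hg) (hρ.mul hh) fun x y => ?_
  simp only [Pi.mul_apply]
  rw [mul_mul_mul_comm, mul_pow]
  exact mul_le_mul' (hρ' x y) (hfgh x y)

theorem midpointPrekopaLeindler_gaussianReal : MidpointPrekopaLeindler (gaussianReal 0 1) := by
  rw [gaussianReal_of_var_ne_zero _ one_ne_zero]
  refine midpointPrekopaLeindler_volume.withDensity (measurable_gaussianPDF 0 1) fun x y => ?_
  simp only [gaussianPDF, ← ENNReal.ofReal_pow (gaussianPDFReal_nonneg _ _ _),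
    ← ENNReal.ofReal_mul (gaussianPDFReal_nonneg _ _ _)]
  refine ENNReal.ofReal_le_ofReal ?_
  simp only [gaussianPDFReal]
  rw [mul_mul_mul_comm, mul_pow, ← sq, ← Real.exp_add, ← Real.exp_nat_mul]
  gcongr
  simp only [smul_eq_mul, NNReal.coe_one]
  push_cast
  -- The two exponents differ by `(x - y) ^ 2 / 4`.
  nlinarith [sq_nonneg (x - y)]

theorem MidpointPrekopaLeindler.map {E F : Type*} [Add E] [SMul ℝ E] [MeasurableSpace E]
    [Add F] [SMul ℝ F] [MeasurableSpace F] {μ : Measure E} (hμ : MidpointPrekopaLeindler μ)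
    {T : E → F} (hT : Measurable T)
    (hT' : ∀ x y, T ((2⁻¹ : ℝ) • (x + y)) = (2⁻¹ : ℝ) • (T x + T y)) :
    MidpointPrekopaLeindler (μ.map T) := by
  intro f g h hf hg hh hfgh
  rw [lintegral_map hf hT, lintegral_map hg hT, lintegral_map hh hT]
  refine hμ _ _ _ (hf.comp hT) (hg.comp hT) (hh.comp hT) fun x y => ?_
  rw [hT']
  exact hfgh _ _

/-- By Tonelli: the property of `ν` on fibres is exactly the hypothesis that `μ` needs for the
partial integrals. -/
theorem MidpointPrekopaLeindler.prod {E F : Type*} [Add E] [SMul ℝ E] [MeasurableSpace E]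
    [Add F] [SMul ℝ F] [MeasurableSpace F] {μ : Measure E} {ν : Measure F} [SFinite μ] [SFinite ν]
    (hμ : MidpointPrekopaLeindler μ) (hν : MidpointPrekopaLeindler ν) :
    MidpointPrekopaLeindler (μ.prod ν) := by
  intro f g h hf hg hh hfgh
  rw [lintegral_prod _ hf.aemeasurable, lintegral_prod _ hg.aemeasurable,
    lintegral_prod _ hh.aemeasurable]
  refine hμ _ _ _ hf.lintegral_prod_right' hg.lintegral_prod_right' hh.lintegral_prod_right'
    fun x y => ?_
  exact hν _ _ _ (hf.comp measurable_prodMk_left) (hg.comp measurable_prodMk_left)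
    (hh.comp measurable_prodMk_left) fun u v => hfgh (x, u) (y, v)

theorem MidpointPrekopaLeindler.pi {n : ℕ} {μ : Measure ℝ} [SigmaFinite μ]
    (hμ : MidpointPrekopaLeindler μ) :
    MidpointPrekopaLeindler (Measure.pi fun _ : Fin n => μ) := by
  induction n with
  | zero =>
    intro f g h _ _ _ hfgh
    rw [Measure.pi_of_empty]
    simp only [lintegral_dirac]
    convert hfgh _ _
  | succ n ih =>
    have h := (measurePreserving_piFinSuccAbove (fun _ : Fin (n + 1) => μ) 0).symm
    rw [← h.map_eq]
    refine (hμ.prod ih).map h.measurable fun x y => ?_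
    ext i
    refine Fin.cases ?_ (fun j => ?_) i <;> simp [MeasurableEquiv.piFinSuccAbove, mul_add]

/-- Anderson's inequality: a translation does not increase the mass of a symmetric convex set. -/
theorem MidpointPrekopaLeindler.measure_translate_le {E : Type*} [AddCommGroup E] [Module ℝ E]
    [MeasurableSpace E] [MeasurableAdd E] [MeasurableNeg E] {μ : Measure E}
    (hμ : MidpointPrekopaLeindler μ) (hneg : μ.map Neg.neg = μ) {C : Set E}
    (hC : MeasurableSet C) (hconv : Convex ℝ C) (hsymm : ∀ x ∈ C, -x ∈ C) (y : E) :
    μ ((fun x => x + y) ⁻¹' C) ≤ μ C := by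
  have hA : MeasurableSet ((fun x => x + y) ⁻¹' C) := measurable_add_const y hC
  have hB : MeasurableSet ((fun x => x + -y) ⁻¹' C) := measurable_add_const (-y) hC
  have hAB : μ ((fun x => x + -y) ⁻¹' C) = μ ((fun x => x + y) ⁻¹' C) := by
    conv_lhs => rw [← hneg, Measure.map_apply measurable_neg hB]
    congr 1
    ext x
    have : -(x + y) = -x + -y := neg_add x y
    simp only [Set.mem_preimage]
    exact ⟨fun h => by simpa [add_comm] using hsymm _ h, fun h => this ▸ hsymm _ h⟩
  -- The opposite shifts cancel at the midpoint, so convexity sends the midpoints of `C - y` and `C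
  -- + y` into `C`; by symmetry these two translates have equal mass.
  have key := hμ _ _ _ (measurable_one.indicator hA) (measurable_one.indicator hB)
    (measurable_one.indicator hC) fun u v => by
      by_cases hu : u + y ∈ C
      · by_cases hv : v + -y ∈ C
        · have : (2⁻¹ : ℝ) • (u + v) ∈ C := by
            have := hconv hu hv (a := 2⁻¹) (b := 2⁻¹) (by norm_num) (by norm_num) (by norm_num)
            rwa [← smul_add, add_add_add_comm, add_neg_cancel, add_zero] at this
          rw [Set.indicator_of_mem (show u ∈ _ from hu), Set.indicator_of_mem (show v ∈ _ from hv),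
            Set.indicator_of_mem this]
          simp
        · rw [Set.indicator_of_notMem (show v ∉ (fun x => x + -y) ⁻¹' C from hv)]
          simp
      · rw [Set.indicator_of_notMem (show u ∉ (fun x => x + y) ⁻¹' C from hu)]
        simp
  rw [lintegral_indicator_one hA, lintegral_indicator_one hB, lintegral_indicator_one hC, hAB,
    ← sq] at key
  by_contra hcon
  rw [sq, sq] at key
  exact absurd key (not_le.2 (ENNReal.mul_lt_mul (not_le.1 hcon) (not_le.1 hcon)))

theorem midpointPrekopaLeindler_stdGaussian {E : Type*} [NormedAddCommGroup E]
    [InnerProductSpace ℝ E] [FiniteDimensional ℝ E] [MeasurableSpace E] [BorelSpace E] :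
    MidpointPrekopaLeindler (stdGaussian E) := by
  rw [stdGaussian]
  refine midpointPrekopaLeindler_gaussianReal.pi.map (by fun_prop) fun x y => ?_
  simp [add_smul, mul_smul, Finset.sum_add_distrib, Finset.smul_sum]

theorem midpointPrekopaLeindler_multivariateGaussian {ι : Type*} [Fintype ι] [DecidableEq ι]
    (m : EuclideanSpace ℝ ι) (S : Matrix ι ι ℝ) :
    MidpointPrekopaLeindler (multivariateGaussian m S) := by
  rw [multivariateGaussian]
  refine midpointPrekopaLeindler_stdGaussian.map (by fun_prop) fun x y => ?_
  rw [map_smul, map_add]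
  module

/-! ### Complex Gaussian laws through their characteristic functions. -/

section ComplexGaussian

variable {N : ℕ}

/-- The complex vector with prescribed real and imaginary parts. -/
noncomputable def complexOfRealComposite (N : ℕ) :
    EuclideanSpace ℝ (Fin N ⊕ Fin N) →L[ℝ] (Fin N → ℂ) :=
  LinearMap.toContinuousLinearMap
    { toFun := fun v n => ⟨v (Sum.inl n), v (Sum.inr n)⟩
      map_add' := fun x y => by ext n; exact Complex.ext (by simp) (by simp)
      map_smul' := fun c x => by ext n; exact Complex.ext (by simp) (by simp) }

theorem complexOfRealComposite_apply (v : EuclideanSpace ℝ (Fin N ⊕ Fin N)) (n : Fin N) :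
    complexOfRealComposite N v n = ⟨v (Sum.inl n), v (Sum.inr n)⟩ := rfl

theorem complexGaussian_eq_map (S : Matrix (Fin N) (Fin N) ℂ) :
    complexGaussian S =
      (multivariateGaussian 0 (realCompositeCov S)).map (complexOfRealComposite N) := rfl

instance (S : Matrix (Fin N) (Fin N) ℂ) : IsGaussian (complexGaussian S) := by
  rw [complexGaussian_eq_map]
  infer_instance

theorem midpointPrekopaLeindler_complexGaussian (S : Matrix (Fin N) (Fin N) ℂ) :
    MidpointPrekopaLeindler (complexGaussian S) := by
  rw [complexGaussian_eq_map]
  exact (midpointPrekopaLeindler_multivariateGaussian _ _).map (by fun_prop) fun x y => by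
    rw [map_smul, map_add]

theorem dotProduct_realCompositeCov_mulVec (S : Matrix (Fin N) (Fin N) ℂ)
    (t : Fin N ⊕ Fin N → ℝ) (w : Fin N → ℂ) (hw : ∀ n, w n = ⟨t (Sum.inl n), t (Sum.inr n)⟩) :
    t ⬝ᵥ (realCompositeCov S *ᵥ t) = 1 / 2 * (star w ⬝ᵥ (S *ᵥ w)).re := by
  simp only [dotProduct, Matrix.mulVec, realCompositeCov, Fintype.sum_sum_type, Matrix.smul_apply,
    Matrix.fromBlocks_apply₁₁, Matrix.fromBlocks_apply₁₂, Matrix.fromBlocks_apply₂₁,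
    Matrix.fromBlocks_apply₂₂, Matrix.map_apply, Matrix.neg_apply, Complex.re_sum, Pi.star_apply,
    Complex.mul_re, Complex.mul_im, Finset.mul_sum, hw, RCLike.star_def,
    Complex.conj_re, Complex.conj_im, smul_eq_mul, ← Finset.sum_add_distrib]
  refine Finset.sum_congr rfl fun k _ => Finset.sum_congr rfl fun l _ => ?_
  ring

theorem realCompositeCov_posSemidef {S : Matrix (Fin N) (Fin N) ℂ} (hS : S.PosSemidef) :
    (realCompositeCov S).PosSemidef := by
  refine Matrix.PosSemidef.of_dotProduct_mulVec_nonneg ?_ fun t => ?_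
  · have hherm : ∀ k l, star (S l k) = S k l := fun k l => hS.1.apply k l
    have hre : ∀ k l, (S l k).re = (S k l).re := fun k l => by
      rw [← hherm k l]; simp
    have him : ∀ k l, (S l k).im = -(S k l).im := fun k l => by
      rw [← hherm k l]; simp
    ext (k | k) (l | l) <;> simp [realCompositeCov, hre k l, him k l]
  · rw [star_trivial, dotProduct_realCompositeCov_mulVec S t _ fun n => rfl]
    have := (Complex.le_def.1 (hS.dotProduct_mulVec_nonneg
      (fun n => (⟨t (Sum.inl n), t (Sum.inr n)⟩ : ℂ)))).1
    rw [Complex.zero_re] at this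
    positivity

/-- The real-linear functional `v ↦ Re (wᴴ v)`. -/
noncomputable def reDotProduct (w : Fin N → ℂ) : StrongDual ℝ (Fin N → ℂ) :=
  LinearMap.toContinuousLinearMap
    { toFun := fun v => (star w ⬝ᵥ v).re
      map_add' := fun x y => by simp
      map_smul' := fun c x => by simp }

theorem reDotProduct_apply (w v : Fin N → ℂ) : reDotProduct w v = (star w ⬝ᵥ v).re := rfl

/-- Reduces equality of laws to test functionals indexed by complex vectors, on which the
characteristic function is a Hermitian form in `w`. -/
theorem exists_eq_reDotProduct (L : StrongDual ℝ (Fin N → ℂ)) : ∃ w, L = reDotProduct w := by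
  refine ⟨fun n => ⟨L (Pi.single n 1), L (Pi.single n Complex.I)⟩, ?_⟩
  ext v
  have hv : v = ∑ n, ((v n).re • (Pi.single n 1 : Fin N → ℂ) +
      (v n).im • (Pi.single n Complex.I : Fin N → ℂ)) := by
    ext m
    simp only [Finset.sum_apply, Pi.add_apply, Pi.smul_apply, Pi.single_apply, smul_ite, smul_zero,
      Finset.sum_add_distrib, Finset.sum_ite_eq, Finset.mem_univ, if_true]
    simp
  conv_lhs => rw [hv]
  simp [reDotProduct_apply, dotProduct, mul_comm]

theorem charFunDual_complexGaussian {S : Matrix (Fin N) (Fin N) ℂ} (hS : S.PosSemidef)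
    (w : Fin N → ℂ) :
    charFunDual (complexGaussian S) (reDotProduct w) =
      Complex.exp (-((1 / 4 * (star w ⬝ᵥ (S *ᵥ w)).re : ℝ) : ℂ)) := by
  set t : EuclideanSpace ℝ (Fin N ⊕ Fin N) :=
    WithLp.toLp 2 (Sum.elim (fun n => (w n).re) (fun n => (w n).im)) with ht
  have hL : (reDotProduct w).comp (complexOfRealComposite N) =
      InnerProductSpace.toDualMap ℝ _ t := by
    ext v
    simp [reDotProduct_apply, complexOfRealComposite_apply, dotProduct, ht, PiLp.inner_apply,
      Finset.sum_add_distrib, mul_comm]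
  rw [complexGaussian_eq_map, charFunDual_map, hL, ← charFun_eq_charFunDual_toDualMap,
    charFun_multivariateGaussian (realCompositeCov_posSemidef hS),
    dotProduct_realCompositeCov_mulVec S t w fun n => by simp [ht]]
  -- The constant 1/4 is the Gaussian 1/2 times the 1/2 in `realCompositeCov`.
  congr 1
  simp
  ring

theorem complexGaussian_ext {μ ν : Measure (Fin N → ℂ)} [IsFiniteMeasure μ] [IsFiniteMeasure ν]
    (h : ∀ w, charFunDual μ (reDotProduct w) = charFunDual ν (reDotProduct w)) : μ = ν := by
  refine Measure.ext_of_charFunDual (funext fun L => ?_)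
  obtain ⟨w, rfl⟩ := exists_eq_reDotProduct L
  exact h w

theorem complexGaussian_map_mulVec {S : Matrix (Fin N) (Fin N) ℂ} (hS : S.PosSemidef)
    (M : Matrix (Fin N) (Fin N) ℂ) :
    (complexGaussian S).map (fun v => M *ᵥ v) = complexGaussian (M * S * Mᴴ) := by
  set T : (Fin N → ℂ) →L[ℝ] (Fin N → ℂ) :=
    LinearMap.toContinuousLinearMap (M.mulVecLin.restrictScalars ℝ) with hT
  change (complexGaussian S).map T = _
  refine complexGaussian_ext fun w => ?_
  have hL : (reDotProduct w).comp T = reDotProduct (Mᴴ *ᵥ w) := by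
    ext v
    simp only [hT, ContinuousLinearMap.comp_apply, reDotProduct_apply, Matrix.star_mulVec,
      Matrix.conjTranspose_conjTranspose]
    rw [← Matrix.dotProduct_mulVec]
    rfl
  rw [charFunDual_map, hL, charFunDual_complexGaussian hS,
    charFunDual_complexGaussian (hS.mul_mul_conjTranspose_same M), Matrix.star_mulVec,
    Matrix.conjTranspose_conjTranspose, ← Matrix.dotProduct_mulVec, Matrix.mulVec_mulVec,
    Matrix.mulVec_mulVec, mul_assoc]

theorem complexGaussian_map_neg {S : Matrix (Fin N) (Fin N) ℂ} (hS : S.PosSemidef) :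
    (complexGaussian S).map Neg.neg = complexGaussian S := by
  have h := complexGaussian_map_mulVec hS (-1)
  simpa [Matrix.neg_mulVec] using h

theorem complexGaussian_conv {S T : Matrix (Fin N) (Fin N) ℂ} (hS : S.PosSemidef)
    (hT : T.PosSemidef) :
    complexGaussian S ∗ complexGaussian T = complexGaussian (S + T) := by
  refine complexGaussian_ext fun w => ?_
  rw [charFunDual_conv, charFunDual_complexGaussian hS, charFunDual_complexGaussian hT,
    charFunDual_complexGaussian (hS.add hT), ← Complex.exp_add, Matrix.add_mulVec, dotProduct_add,
    Complex.add_re]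
  congr 1
  push_cast
  ring

/-- A symmetric convex set has larger mass under a complex Gaussian law with smaller covariance. -/
theorem complexGaussian_add_le {S T : Matrix (Fin N) (Fin N) ℂ} (hS : S.PosSemidef)
    (hT : T.PosSemidef) {C : Set (Fin N → ℂ)} (hC : MeasurableSet C) (hconv : Convex ℝ C)
    (hsymm : ∀ x ∈ C, -x ∈ C) :
    complexGaussian (S + T) C ≤ complexGaussian S C := by
  rw [add_comm, ← complexGaussian_conv hT hS, Measure.conv, Measure.map_apply measurable_add hC,
    Measure.prod_apply (measurable_add hC)]
  -- Fixing the `T`-component `y` leaves the `S`-law shifted by `y`.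
  calc ∫⁻ y, complexGaussian S (Prod.mk y ⁻¹' ((fun x => x.1 + x.2) ⁻¹' C)) ∂complexGaussian T
      ≤ ∫⁻ _, complexGaussian S C ∂complexGaussian T := by
        refine lintegral_mono fun y => ?_
        have h := (midpointPrekopaLeindler_complexGaussian S).measure_translate_le
          (complexGaussian_map_neg hS) hC hconv hsymm y
        simpa only [← Set.preimage_comp, Function.comp_def, add_comm] using h
    _ = complexGaussian S C := by simp

end ComplexGaussian

/-! ### Gain events and the Karhunen–Loève splitting. -/

/-- The sign of `x` matters when `N = 0`: the empty real supremum is 0. -/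
theorem maxGain_le_iff {N : ℕ} {η x : ℝ} (hx : 0 ≤ x) (g : Fin N → ℂ) :
    maxGain η g ≤ x ↔ ∀ n, ‖g n‖ ^ 2 / η ≤ x :=
  ⟨fun h n => (le_ciSup (f := fun n => ‖g n‖ ^ 2 / η) (Set.finite_range _).bddAbove n).trans h,
    fun h => Real.iSup_le h hx⟩

theorem maxGain_le_iff_norm_le {N : ℕ} {η x : ℝ} (hη : 0 < η) (hx : 0 ≤ x) (g : Fin N → ℂ) :
    maxGain η g ≤ x ↔ ∀ n, ‖g n‖ ≤ √(x * η) := by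
  rw [maxGain_le_iff hx]
  refine forall_congr' fun n => ?_
  rw [div_le_iff₀ hη, Real.le_sqrt (norm_nonneg _) (by positivity)]

theorem setOf_maxGain_le {N : ℕ} {η x : ℝ} (hη : 0 < η) (hx : 0 ≤ x) :
    {g : Fin N → ℂ | maxGain η g ≤ x} = Metric.closedBall 0 (√(x * η)) := by
  ext g
  rw [Set.mem_ofPred_eq, maxGain_le_iff_norm_le hη hx, mem_closedBall_zero_iff,
    pi_norm_le_iff_of_nonneg (Real.sqrt_nonneg _)]

/-- The matrix mapping the modes in `s` to the channel in the Karhunen–Loève expansion. -/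
noncomputable def klMatrix {N : ℕ} (η : ℝ) (U : Matrix (Fin N) (Fin N) ℂ) (lam : Fin N → ℝ)
    (s : Set (Fin N)) : Matrix (Fin N) (Fin N) ℂ :=
  U * Matrix.diagonal (fun k => s.indicator (fun k => (√η : ℂ) * √(lam k)) k)

theorem klTruncation_eq_mulVec {N : ℕ} (η : ℝ) (U : Matrix (Fin N) (Fin N) ℂ) (lam : Fin N → ℝ)
    (K : ℕ) (z : Fin N → ℂ) :
    klTruncation η U lam K z = klMatrix η U lam {k | k.val < K} *ᵥ z := by
  ext n
  simp only [klTruncation, klMatrix, Matrix.mulVec, dotProduct, Matrix.mul_diagonal,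
    Set.indicator_apply, Set.mem_ofPred_eq, Finset.mul_sum, Finset.sum_filter]
  refine Finset.sum_congr rfl fun k _ => ?_
  split_ifs
  · ring
  · simp

theorem klMatrix_mul_conjTranspose {N : ℕ} {η : ℝ} (hη : 0 ≤ η) (U : Matrix (Fin N) (Fin N) ℂ)
    {lam : Fin N → ℝ} (hlam : ∀ k, 0 ≤ lam k) (s : Set (Fin N)) :
    klMatrix η U lam s * (klMatrix η U lam s)ᴴ =
      U * Matrix.diagonal (fun k => s.indicator (fun k => (η : ℂ) * lam k) k) * Uᴴ := by
  rw [klMatrix, Matrix.conjTranspose_mul, Matrix.diagonal_conjTranspose, mul_assoc,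
    ← mul_assoc (Matrix.diagonal _) (Matrix.diagonal _), Matrix.diagonal_mul_diagonal, ← mul_assoc]
  congr 3
  ext k
  by_cases hk : k ∈ s
  · simp only [hk, Set.indicator_of_mem, Pi.star_apply, RCLike.star_def, map_mul,
      Complex.conj_ofReal]
    rw [mul_mul_mul_comm, ← Complex.ofReal_mul, ← Complex.ofReal_mul, Real.mul_self_sqrt hη, Real.mul_self_sqrt (hlam k)]
  · simp [hk]

/-- Conjugating `R` back by `U` gives a positive semidefinite diagonal matrix. -/
theorem eigenvalue_nonneg {N : ℕ} {R U : Matrix (Fin N) (Fin N) ℂ} (hR : R.PosSemidef)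
    (hU : U ∈ Matrix.unitaryGroup (Fin N) ℂ) {lam : Fin N → ℝ}
    (hdec : R = U * Matrix.diagonal (fun k => (lam k : ℂ)) * Uᴴ) (k : Fin N) : 0 ≤ lam k := by
  have hUU : Uᴴ * U = 1 := Matrix.mem_unitaryGroup_iff'.1 hU
  have h := hR.conjTranspose_mul_mul_same U
  rw [hdec, mul_assoc, mul_assoc, mul_assoc, hUU, mul_one, ← mul_assoc, hUU, one_mul,
    Matrix.posSemidef_diagonal_iff] at h
  exact Complex.zero_le_real.1 (h k)

theorem maxGainCDF_le_maxGainCDF_klTruncation {N : ℕ} {η : ℝ} (hη : 0 < η)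
    {R : Matrix (Fin N) (Fin N) ℂ} (hR : R.PosSemidef)
    {U : Matrix (Fin N) (Fin N) ℂ} (hU : U ∈ Matrix.unitaryGroup (Fin N) ℂ) {lam : Fin N → ℝ}
    (hdec : R = U * Matrix.diagonal (fun k => (lam k : ℂ)) * Uᴴ)
    {Ω : Type*} [MeasurableSpace Ω] {P : Measure Ω}
    {g : Ω → Fin N → ℂ} (hg : HasLaw g (complexGaussian ((η : ℂ) • R)) P)
    {Ω' : Type*} [MeasurableSpace Ω'] {P' : Measure Ω'}
    {z : Ω' → Fin N → ℂ} (hz : HasLaw z (complexGaussian 1) P') (K : ℕ) {x : ℝ} (hx : 0 ≤ x) :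
    maxGainCDF P η g x ≤ maxGainCDF P' η (fun ω => klTruncation η U lam K (z ω)) x := by
  have hlam := eigenvalue_nonneg hR hU hdec
  set s : Set (Fin N) := {k | k.val < K} with hs
  set A := klMatrix η U lam s with hA
  set B := klMatrix η U lam sᶜ with hB
  -- The indicators of `s` and `sᶜ` add up to the full spectrum.
  have hsum : (η : ℂ) • R = A * Aᴴ + B * Bᴴ := by
    rw [hA, hB, klMatrix_mul_conjTranspose hη.le U hlam, klMatrix_mul_conjTranspose hη.le U hlam,
      ← add_mul, ← mul_add, Matrix.diagonal_add, hdec, ← Matrix.smul_mul, ← Matrix.mul_smul,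
      ← Matrix.diagonal_smul]
    congr 3
    ext k
    rw [← Pi.add_apply, Set.indicator_self_add_compl]
    simp
  set C : Set (Fin N → ℂ) := {g | maxGain η g ≤ x} with hC
  have hCball : C = Metric.closedBall 0 (√(x * η)) := setOf_maxGain_le hη hx
  have hCm : MeasurableSet C := hCball ▸ Metric.isClosed_closedBall.measurableSet
  have hle : complexGaussian (A * Aᴴ + B * Bᴴ) C ≤ complexGaussian (A * Aᴴ) C :=
    complexGaussian_add_le (Matrix.posSemidef_self_mul_conjTranspose A)
      (Matrix.posSemidef_self_mul_conjTranspose B) hCm (hCball ▸ convex_closedBall _ _)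
      fun y hy => by rw [hCball] at hy ⊢; simpa using hy
  have hzlaw : HasLaw (fun ω => klTruncation η U lam K (z ω)) (complexGaussian (A * Aᴴ)) P' := by
    have hm : HasLaw (fun v => A *ᵥ v) (complexGaussian (A * Aᴴ)) (complexGaussian 1) :=
      ⟨(by fun_prop : Measurable fun v : Fin N → ℂ => A *ᵥ v).aemeasurable,
        by rw [complexGaussian_map_mulVec Matrix.PosSemidef.one, mul_one]⟩
    simp only [klTruncation_eq_mulVec]
    exact hm.comp hz
  have hP : maxGainCDF P η g x = (complexGaussian ((η : ℂ) • R)).real C := by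
    rw [← hg.map_eq, map_measureReal_apply_of_aemeasurable hg.aemeasurable hCm]
    rfl
  have hP' : maxGainCDF P' η (fun ω => klTruncation η U lam K (z ω)) x =
      (complexGaussian (A * Aᴴ)).real C := by
    rw [← hzlaw.map_eq, map_measureReal_apply_of_aemeasurable hzlaw.aemeasurable hCm]
    rfl
  rw [hP, hP', hsum]
  exact ENNReal.toReal_mono (measure_ne_top _ _) hle

theorem outageProb_eq_maxGainCDF {Ω : Type*} [MeasurableSpace Ω] {N : ℕ} (P : Measure Ω) (η : ℝ)
    {γbar : ℝ} (hγ : 0 < γbar) (g : Ω → Fin N → ℂ) (γth : ℝ) :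
    outageProb P η γbar g γth = maxGainCDF P η g (γth / γbar) := by
  simp only [outageProb, maxGainCDF, le_div_iff₀' hγ]

theorem theorem1 {N : ℕ} (η : ℝ) (hη : 0 < η)
    (R : Matrix (Fin N) (Fin N) ℂ) (hR : R.PosSemidef)
    (U : Matrix (Fin N) (Fin N) ℂ) (hU : U ∈ Matrix.unitaryGroup (Fin N) ℂ)
    (lam : Fin N → ℝ) (hlam : Antitone lam)
    (hdec : R = U * Matrix.diagonal (fun k => (lam k : ℂ)) * Uᴴ)
    {Ω : Type*} [MeasurableSpace Ω] (P : Measure Ω) [IsProbabilityMeasure P]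
    (g : Ω → Fin N → ℂ) (hg : HasLaw g (complexGaussian ((η : ℂ) • R)) P)
    {Ω' : Type*} [MeasurableSpace Ω'] (P' : Measure Ω') [IsProbabilityMeasure P']
    (z : Ω' → Fin N → ℂ) (hz : HasLaw z (complexGaussian 1) P')
    (K : ℕ) (hK : K ≤ N) :
    (∀ x : ℝ, 0 < x →
      maxGainCDF P η g x ≤ maxGainCDF P' η (fun ω => klTruncation η U lam K (z ω)) x) ∧
    (∀ γbar γth : ℝ, 0 < γbar → 0 < γth →
      outageProb P η γbar g γth ≤
        outageProb P' η γbar (fun ω => klTruncation η U lam K (z ω)) γth) := by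
  have key := fun x hx => maxGainCDF_le_maxGainCDF_klTruncation hη hR hU hdec hg hz K (x := x) hx
  refine ⟨fun x hx => key x hx.le, fun γbar γth hbar hth => ?_⟩
  rw [outageProb_eq_maxGainCDF P η hbar, outageProb_eq_maxGainCDF P' η hbar]
  exact key _ (div_pos hth hbar).le
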